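/- Let $k,n,m$ be natural numbers with $m\ge 1$, let $E\subset\mathbb R^k$ be compact with Lebesgue measure $\mu(E)$, and let $\lambda>0$, $\rho>0$. Below $\|\cdot\|$ is the Euclidean norm on vectors and the induced operator norm on $n\times m$ matrices, and $\|\cdot\|_2$, $\|\cdot\|_\infty$ are the norms of $L_2$, $L_\infty$ over $E$ or $E\times E$ with Lebesgue measure. Consider $$x(\xi)=f(\xi,x(\xi))+\lambda\int_E\big[K_1(\xi,s,x(s))+K_2(\xi,s,x(s))\,u(s)\big]\,ds, \qquad (1)$$ where $f(\xi,x)\in\mathbb R^n$, $K_1(\xi,s,x)\in\mathbb R^n$, $K_2(\xi,s,x)\in\mathbb R^{n\times m}$ for $\xi,s\in E$, $x\in\mathbb R^n$, under the following conditions. (A) $f(\cdot,x)$ is Lebesgue measurable for every $x$, $f(\cdot,0)\in L_2(E;\mathbb R^n)$, and there is $\gamma_0\in L_\infty(E;\mathbb R)$ such that for a.a. $\xi$: $\|f(\xi,x_1)-f(\xi,x_2)\|\le\gamma_0(\xi)\|x_1-x_2\|$ for all $x_1,x_2\in\mathbb R^n$. (B) $K_1(\cdot,\cdot,x)$ is Lebesgue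 measurable for every $x$, $K_1(\cdot,\cdot,0)\in L_2(E\times E;\mathbb R^n)$, and there is $\gamma_1\in L_2(E\times E;\mathbb R)$ such that for a.a. $(\xi,s)$: $\|K_1(\xi,s,x_1)-K_1(\xi,s,x_2)\|\le\gamma_1(\xi,s)\|x_1-x_2\|$ for all $x_1,x_2$. (C) $K_2(\cdot,\cdot,x)$ is Lebesgue measurable for every $x$, $K_2(\cdot,\cdot,0)\in L_2(E\times E;\mathbb R^{n\times m})$, and there is $\gamma_2\in L_\infty(E\times E;\mathbb R)$ such that for a.a. $(\xi,s)$: $\|K_2(\xi,s,x_1)-K_2(\xi,s,x_2)\|\le\gamma_2(\xi,s)\|x_1-x_2\|$ for all $x_1,x_2$. (D) $6\big[\kappa_0^2+\lambda^2\kappa_1^2+\lambda^2\rho^2\kappa_2^2\mu(E)\big]<1$, where $\kappa_0=\|\gamma_0\|_\infty$, $\kappa_1=\|\gamma_1\|_2$, $\kappa_2=\|\gamma_2\|_\infty$. Let $V_\rho=\{u\in L_2(E;\mathbb R^m):\|u\|_2\le\rho\}$. A trajectory generated by $u\in V_\rho$ is a function $x\in L_2(E;\mathbb R^n)$ satisfying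 (1) for a.a. $\xi\in E$. Let $Z_\rho\subset L_2(E;\mathbb R^n)$ be the set of all trajectories generated by all $u\in V_\rho$, and put $$c_*=\left[\frac{16\lambda^2\rho^2\big[(\kappa_2+1)^2\mu(E)+1\big]}{(1-\kappa_0)^2-4\lambda^2\big[\kappa_1^2+\rho^2\kappa_2^2\mu(E)\big]}\right]^{1/2}.$$ A finite $\Delta$-partition of $E$ is a finite system $\Gamma=\{E_1,\dots,E_N\}$ of pairwise disjoint Lebesgue measurable sets of diameter at most $\Delta$ with union $E$. For $\alpha>0$, a uniform partition of $[0,\alpha]$ with step $\delta$ is $\Lambda=\{0=r_0,r_1,\dots,r_q=\alpha\}$ with $r_{j+1}-r_j=\delta$ for $j=0,\dots,q-1$. A finite $\sigma$-net of the unit sphere $S\subset\mathbb R^m$ is a finite set $S_\sigma\subset S$ such that each point of $S$ is at distance at most $\sigma$ from a point of $S_\sigma$. Given these, let $V_\rho^{\alpha,\Gamma,\Lambda,\sigma}$ be the set of all $u\in L_2(E;\mathbb R^m)$ for which there are $r_{j_i}\in\Lambda$, $b_{l_i}\in S_\sigma$ $(i=1,\dots,N)$ with $u(s)=r_{j_i}b_{l_i}$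 for $s\in E_i$ and $\sum_{i=1}^N\mu(E_i)r_{j_i}^2\le\rho^2$, and let $Z_\rho^{\alpha,\Gamma,\Lambda,\sigma}$ be the set of trajectories generated by the controls in $V_\rho^{\alpha,\Gamma,\Lambda,\sigma}$. **Theorem.** For every $\varepsilon>0$ there exist $\alpha_*=\alpha_*(\varepsilon)>0$, $\Delta_*=\Delta_*(\varepsilon)>0$, $\delta_*=\delta_*(\varepsilon)>0$ and $\sigma_*=\sigma_*(\varepsilon,\alpha_*)>0$ such that for all $\Delta\in(0,\Delta_*]$, $\delta\in(0,\delta_*]$, $\sigma\in(0,\sigma_*]$, every finite $\Delta$-partition $\Gamma$ of $E$, every uniform partition $\Lambda$ of $[0,\alpha_*]$ with step $\delta$, and every finite $\sigma$-net $S_\sigma$ of $S$, the set $Z_\rho^{\alpha_*,\Gamma,\Lambda,\sigma}$ is a nonempty finite subset of $Z_\rho$, and $$h_2\big(Z_\rho,\,Z_\rho^{\alpha_*,\Gamma,\Lambda,\sigma}\big)\le(c_*+1)\,\varepsilon,$$ where $h_2$ is the Hausdorff distance between subsets of $L_2(E;\mathbb R^n)$. -/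

import Mathlib

open MeasureTheory Set
open scoped ENNReal

noncomputable section

/-- The data of the control system
`x(ξ) = f(ξ, x(ξ)) + lam * ∫_E [K₁(ξ,s,x(s)) + K₂(ξ,s,x(s)) u(s)] ds`
with `E ⊆ ℝᵏ`, state in `ℝⁿ` and control in `ℝᵐ` (Euclidean norms). The `n × m` matrices are
the linear maps from `ℝᵐ` to `ℝⁿ`, with the operator norm. Only the values of `f`, `K₁`, `K₂` for
`ξ, s ∈ E` play a role. -/
structure UrysohnSystem (k n m : ℕ) where
  E : Set (EuclideanSpace ℝ (Fin k))
  f : EuclideanSpace ℝ (Fin k) → EuclideanSpace ℝ (Fin n) → EuclideanSpace ℝ (Fin n)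
  K₁ : EuclideanSpace ℝ (Fin k) → EuclideanSpace ℝ (Fin k) →
    EuclideanSpace ℝ (Fin n) → EuclideanSpace ℝ (Fin n)
  K₂ : EuclideanSpace ℝ (Fin k) → EuclideanSpace ℝ (Fin k) → EuclideanSpace ℝ (Fin n) →
    (EuclideanSpace ℝ (Fin m) →L[ℝ] EuclideanSpace ℝ (Fin n))
  lam : ℝ

namespace UrysohnSystem

variable {k n m : ℕ}

/-- Lebesgue measure on `E`. Lebesgue measurability of a function on `E` is
`AEStronglyMeasurable` with respect to this measure (equality a.e. with a Borel function). -/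
abbrev μE (S : UrysohnSystem k n m) : Measure (EuclideanSpace ℝ (Fin k)) :=
  volume.restrict S.E

/-- Lebesgue measure on `E × E`. -/
abbrev μEE (S : UrysohnSystem k n m) :
    Measure (EuclideanSpace ℝ (Fin k) × EuclideanSpace ℝ (Fin k)) :=
  S.μE.prod S.μE

/-- The space `L₂(E; ℝᵐ)` of controls. -/
abbrev ControlSpace (S : UrysohnSystem k n m) :=
  Lp (EuclideanSpace ℝ (Fin m)) 2 S.μE

/-- The space `L₂(E; ℝⁿ)` of states. -/
abbrev StateSpace (S : UrysohnSystem k n m) :=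
  Lp (EuclideanSpace ℝ (Fin n)) 2 S.μE

/-- Condition on `f`, with Lipschitz modulus `γ₀ ∈ L_∞(E)`. -/
structure CondA (S : UrysohnSystem k n m) (γ₀ : EuclideanSpace ℝ (Fin k) → ℝ) : Prop where
  measurable : ∀ x, AEStronglyMeasurable (fun ξ => S.f ξ x) S.μE
  zero_mem : MemLp (fun ξ => S.f ξ 0) 2 S.μE
  gamma_mem : MemLp γ₀ ∞ S.μE
  lipschitz : ∀ᵐ ξ ∂S.μE, ∀ x₁ x₂, ‖S.f ξ x₁ - S.f ξ x₂‖ ≤ γ₀ ξ * ‖x₁ - x₂‖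

/-- Condition on `K₁`, with Lipschitz modulus `γ₁ ∈ L₂(E × E)`. -/
structure CondB (S : UrysohnSystem k n m)
    (γ₁ : EuclideanSpace ℝ (Fin k) × EuclideanSpace ℝ (Fin k) → ℝ) : Prop where
  measurable : ∀ x, AEStronglyMeasurable (fun p => S.K₁ p.1 p.2 x) S.μEE
  zero_mem : MemLp (fun p => S.K₁ p.1 p.2 0) 2 S.μEE
  gamma_mem : MemLp γ₁ 2 S.μEE
  lipschitz : ∀ᵐ p ∂S.μEE, ∀ x₁ x₂,
    ‖S.K₁ p.1 p.2 x₁ - S.K₁ p.1 p.2 x₂‖ ≤ γ₁ p * ‖x₁ - x₂‖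

/-- Condition on `K₂`, with Lipschitz modulus `γ₂ ∈ L_∞(E × E)`. -/
structure CondC (S : UrysohnSystem k n m)
    (γ₂ : EuclideanSpace ℝ (Fin k) × EuclideanSpace ℝ (Fin k) → ℝ) : Prop where
  measurable : ∀ x, AEStronglyMeasurable (fun p => S.K₂ p.1 p.2 x) S.μEE
  zero_mem : MemLp (fun p => S.K₂ p.1 p.2 0) 2 S.μEE
  gamma_mem : MemLp γ₂ ∞ S.μEE
  lipschitz : ∀ᵐ p ∂S.μEE, ∀ x₁ x₂,
    ‖S.K₂ p.1 p.2 x₁ - S.K₂ p.1 p.2 x₂‖ ≤ γ₂ p * ‖x₁ - x₂‖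

/-- `κ₀`, the `L_∞(E)` norm of `γ₀`. -/
def kappa₀ (S : UrysohnSystem k n m) (γ₀ : EuclideanSpace ℝ (Fin k) → ℝ) : ℝ :=
  (eLpNorm γ₀ ∞ S.μE).toReal

/-- `κ₁`, the `L₂(E × E)` norm of `γ₁`. -/
def kappa₁ (S : UrysohnSystem k n m)
    (γ₁ : EuclideanSpace ℝ (Fin k) × EuclideanSpace ℝ (Fin k) → ℝ) : ℝ :=
  (eLpNorm γ₁ 2 S.μEE).toReal

/-- `κ₂`, the `L_∞(E × E)` norm of `γ₂`. -/
def kappa₂ (S : UrysohnSystem k n m)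
    (γ₂ : EuclideanSpace ℝ (Fin k) × EuclideanSpace ℝ (Fin k) → ℝ) : ℝ :=
  (eLpNorm γ₂ ∞ S.μEE).toReal

/-- The smallness condition, for given `ρ, κ₀, κ₁, κ₂`. -/
def CondD (S : UrysohnSystem k n m) (ρ κ₀ κ₁ κ₂ : ℝ) : Prop :=
  6 * (κ₀ ^ 2 + S.lam ^ 2 * κ₁ ^ 2 + S.lam ^ 2 * ρ ^ 2 * κ₂ ^ 2 * volume.real S.E) < 1

/-- The constant `c_*`. -/
def cStar (S : UrysohnSystem k n m) (ρ κ₀ κ₁ κ₂ : ℝ) : ℝ :=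
  Real.sqrt ((16 * S.lam ^ 2 * ρ ^ 2 * ((κ₂ + 1) ^ 2 * volume.real S.E + 1)) /
    ((1 - κ₀) ^ 2 - 4 * S.lam ^ 2 * (κ₁ ^ 2 + ρ ^ 2 * κ₂ ^ 2 * volume.real S.E)))

/-- `x ∈ L₂(E; ℝⁿ)` is a trajectory generated by the control `u`: for almost every `ξ ∈ E` the
integral in the equation exists and the equation holds. -/
def IsTrajectory (S : UrysohnSystem k n m) (u : S.ControlSpace) (x : S.StateSpace) : Prop :=
  ∀ᵐ ξ ∂S.μE,
    Integrable (fun s => S.K₁ ξ s (x s) + S.K₂ ξ s (x s) (u s)) S.μE ∧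
    x ξ = S.f ξ (x ξ) + S.lam • ∫ s in S.E, (S.K₁ ξ s (x s) + S.K₂ ξ s (x s) (u s))

/-- The trajectories generated by the controls of a set `V`. -/
def trajectories (S : UrysohnSystem k n m) (V : Set S.ControlSpace) : Set S.StateSpace :=
  {x | ∃ u ∈ V, S.IsTrajectory u x}

/-- `V_ρ`, the admissible controls: the closed ball of radius `ρ` in `L₂(E; ℝᵐ)`. -/
def admissible (S : UrysohnSystem k n m) (ρ : ℝ) : Set S.ControlSpace :=
  {u | ‖u‖ ≤ ρ}

/-- `Z_ρ`, the set of trajectories of the system. -/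
def Z (S : UrysohnSystem k n m) (ρ : ℝ) : Set S.StateSpace :=
  S.trajectories (S.admissible ρ)

/-- The controls equal to `r_{j_i} b_{l_i}` on the `i`-th set of the partition `Γ` of `E`, with
`r_{j_i}` among the points `r` of the partition of `[0, α]`, `b_{l_i}` in the finite set `B` of
unit vectors, and `∑ μ(E_i) r_{j_i}² ≤ ρ²`. (Elements of `L₂` are classes modulo a.e. equality.) -/
def discreteControls (S : UrysohnSystem k n m) (ρ : ℝ) {N q : ℕ}
    (Γ : Fin N → Set (EuclideanSpace ℝ (Fin k))) (r : Fin (q + 1) → ℝ)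
    (B : Finset (EuclideanSpace ℝ (Fin m))) : Set S.ControlSpace :=
  {u | ∃ (j : Fin N → Fin (q + 1)) (b : Fin N → EuclideanSpace ℝ (Fin m)),
    (∀ i, b i ∈ B) ∧
    (∀ i, ∀ᵐ s ∂S.μE, s ∈ Γ i → u s = r (j i) • b i) ∧
    ∑ i, volume.real (Γ i) * r (j i) ^ 2 ≤ ρ ^ 2}

/-- The trajectories generated by the controls in `discreteControls`. -/
def discreteZ (S : UrysohnSystem k n m) (ρ : ℝ) {N q : ℕ}
    (Γ : Fin N → Set (EuclideanSpace ℝ (Fin k))) (r : Fin (q + 1) → ℝ)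
    (B : Finset (EuclideanSpace ℝ (Fin m))) : Set S.StateSpace :=
  S.trajectories (S.discreteControls ρ Γ r B)

end UrysohnSystem

/-- `P` is a finite `Δ`-partition of `Q`: Lebesgue measurable pairwise disjoint sets with union
`Q`, each of diameter at most `Δ`. -/
structure IsDeltaPartition {k N : ℕ} (Q : Set (EuclideanSpace ℝ (Fin k))) (Δ : ℝ)
    (P : Fin N → Set (EuclideanSpace ℝ (Fin k))) : Prop where
  subset : ∀ i, P i ⊆ Q
  measurable : ∀ i, NullMeasurableSet (P i) volume
  disjoint : ∀ i j, i ≠ j → P i ∩ P j = ∅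
  union : Q = ⋃ i, P i
  diam_le : ∀ i, ∀ x ∈ P i, ∀ y ∈ P i, ‖x - y‖ ≤ Δ

/-- `0 = r₀, r₁, …, r_q = α` is a uniform partition of `[0, α]` with step `δ`. -/
structure IsUniformPartition {q : ℕ} (α δ : ℝ) (r : Fin (q + 1) → ℝ) : Prop where
  first : r 0 = 0
  last : r (Fin.last q) = α
  step : ∀ j : Fin q, r j.succ - r j.castSucc = δ

/-- `B` is a finite `σ`-net on the unit sphere of `ℝᵐ`. -/
structure IsSphereNet {m : ℕ} (σ : ℝ) (B : Finset (EuclideanSpace ℝ (Fin m))) : Prop where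
  norm_eq : ∀ b ∈ B, ‖b‖ = 1
  cover : ∀ x : EuclideanSpace ℝ (Fin m), ‖x‖ = 1 → ∃ b ∈ B, ‖x - b‖ ≤ σ

end

/-! Under the smallness condition the right-hand side of the equation is a contraction of
`L₂(E; ℝⁿ)`, uniformly over the controls in `V_ρ`, so every such control generates exactly one
trajectory. For a fixed state the integral is a Hilbert-Schmidt operator applied to the control, up
to a constant; hence the solution map is continuous from the weak topology of `V_ρ` to the norm
topology, and `Z_ρ`, the image of a weakly compact ball, is compact.

Each single control in `V_ρ` is a norm limit of discrete controls: shrink it slightly, approximate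
it by a continuous function of compact support, and round the values of that function on each cell.
The mesh needed depends on the control, but since `Z_ρ` is totally bounded it is enough to
approximate finitely many trajectories, and the mesh becomes uniform. -/

open Filter Topology
open scoped Function

section Measurability

variable {α F G : Type*} [MeasurableSpace α] {μ : Measure α} {h : α → F → G} {x : α → F}

theorem aestronglyMeasurable_comp_of_continuous [TopologicalSpace F] [TopologicalSpace G]
    [TopologicalSpace.PseudoMetrizableSpace G] (hm : ∀ y, AEStronglyMeasurable (fun a => h a y) μ)
    (hc : ∀ᵐ a ∂μ, Continuous (h a)) (hx : AEStronglyMeasurable x μ) :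
    AEStronglyMeasurable (fun a => h a (x a)) μ := by
  have simple_case (φ : SimpleFunc α F) : AEStronglyMeasurable (fun a => h a (φ a)) μ := by
    have hcover : (⋃ y : φ.range, φ ⁻¹' {(y : F)}) = univ :=
      eq_univ_of_forall fun a => mem_iUnion.mpr ⟨⟨φ a, φ.mem_range_self a⟩, rfl⟩
    rw [← Measure.restrict_univ (μ := μ), ← hcover, aestronglyMeasurable_iUnion_iff]
    refine fun y => (hm y).restrict.congr ?_
    filter_upwards [ae_restrict_mem (φ.measurableSet_fiber y)] with a ha
    rw [show φ a = y from ha]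
  refine aestronglyMeasurable_of_tendsto_ae atTop
    (fun j => simple_case (hx.stronglyMeasurable_mk.approx j)) ?_
  filter_upwards [hc, hx.ae_eq_mk] with a ha hxa
  rw [hxa]
  exact (ha.tendsto _).comp (hx.stronglyMeasurable_mk.tendsto_approx a)

theorem aestronglyMeasurable_comp_of_lipschitz [SeminormedAddCommGroup F]
    [SeminormedAddCommGroup G] (hm : ∀ y, AEStronglyMeasurable (fun a => h a y) μ) {γ : α → ℝ}
    (hγ : ∀ᵐ a ∂μ, ∀ y z, ‖h a y - h a z‖ ≤ γ a * ‖y - z‖) (hx : AEStronglyMeasurable x μ) :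
    AEStronglyMeasurable (fun a => h a (x a)) μ := by
  refine aestronglyMeasurable_comp_of_continuous hm ?_ hx
  filter_upwards [hγ] with a ha
  refine (LipschitzWith.of_dist_le' (K := γ a) fun y z => ?_).continuous
  simpa only [dist_eq_norm] using ha y z

end Measurability

section LpSpaces

variable {α β F G : Type*} [MeasurableSpace α] [MeasurableSpace β] {μ : Measure α}
  {ν : Measure β} [NormedAddCommGroup F] [NormedAddCommGroup G] {p : ℝ≥0∞}

theorem memLp_of_norm_sub_le {f g : α → F} {w : α → G} {c : ℝ} (hf : AEStronglyMeasurable f μ)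
    (hg : MemLp g p μ) (hw : MemLp w p μ) (hle : ∀ᵐ a ∂μ, ‖f a - g a‖ ≤ c * ‖w a‖) :
    MemLp f p μ :=
  ((MemLp.of_le_mul hw (hf.sub hg.1) hle).add hg).ae_eq
    (Eventually.of_forall fun _ => sub_add_cancel _ _)

theorem ae_le_toReal_eLpNorm_top {γ : α → ℝ} (hγ : MemLp γ ∞ μ) :
    ∀ᵐ a ∂μ, γ a ≤ (eLpNorm γ ∞ μ).toReal := by
  rw [eLpNorm_exponent_top]
  have hfin : eLpNormEssSup γ μ ≠ ∞ := by simpa only [eLpNorm_exponent_top] using hγ.2.ne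
  filter_upwards [ae_le_eLpNormEssSup (f := γ) (μ := μ)] with a ha
  have := ENNReal.toReal_mono hfin ha
  rw [toReal_enorm] at this
  exact (le_abs_self _).trans this

theorem eLpNorm_comp_snd [SFinite ν] {w : β → F} (hw : AEStronglyMeasurable w ν) (hp : p ≠ ∞) :
    eLpNorm (fun q : α × β => w q.2) p (μ.prod ν) =
      μ univ ^ (1 / p).toReal * eLpNorm w p ν := by
  have hmap : (μ.prod ν).map Prod.snd = μ univ • ν := Measure.map_snd_prod
  have hw' : AEStronglyMeasurable w ((μ.prod ν).map Prod.snd) := hmap ▸ hw.smul_measure _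
  change eLpNorm (w ∘ Prod.snd) p (μ.prod ν) = _
  rw [← eLpNorm_map_measure hw' measurable_snd.aemeasurable, hmap,
    eLpNorm_smul_measure_of_ne_top hp, smul_eq_mul]

theorem eLpNorm_two_sq (g : α → G) : eLpNorm g 2 μ ^ 2 = ∫⁻ a, ‖g a‖ₑ ^ 2 ∂μ := by
  have h := eLpNorm_nnreal_pow_eq_lintegral (μ := μ) (f := g) (p := 2) two_ne_zero
  simpa only [ENNReal.coe_ofNat, NNReal.coe_ofNat, ENNReal.rpow_ofNat] using h

theorem lintegral_enorm_mul_le_eLpNorm_two {f : α → F} {g : α → G}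
    (hf : AEStronglyMeasurable f μ) (hg : AEStronglyMeasurable g μ) :
    ∫⁻ a, ‖f a‖ₑ * ‖g a‖ₑ ∂μ ≤ eLpNorm f 2 μ * eLpNorm g 2 μ := by
  have := ENNReal.lintegral_mul_le_Lp_mul_Lq μ (Real.HolderConjugate.two_two) hf.enorm hg.enorm
  rw [eLpNorm_eq_lintegral_rpow_enorm_toReal two_ne_zero ENNReal.ofNat_ne_top,
    eLpNorm_eq_lintegral_rpow_enorm_toReal two_ne_zero ENNReal.ofNat_ne_top]
  simpa only [Pi.mul_apply, ENNReal.toReal_ofNat] using this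

theorem tendsto_eLpNorm_two_of_dominated {g : ℕ → α → G} (hg : ∀ j, AEStronglyMeasurable (g j) μ)
    {b : α → ℝ≥0∞} (hb : ∫⁻ a, b a ^ 2 ∂μ ≠ ∞) (hle : ∀ j, ∀ᵐ a ∂μ, ‖g j a‖ₑ ≤ b a)
    (hlim : ∀ᵐ a ∂μ, Tendsto (fun j => g j a) atTop (𝓝 0)) :
    Tendsto (fun j => eLpNorm (g j) 2 μ) atTop (𝓝 0) := by
  have hsq : Tendsto (fun j => eLpNorm (g j) 2 μ ^ 2) atTop (𝓝 0) := by
    simp_rw [eLpNorm_two_sq]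
    rw [← lintegral_zero (μ := μ)]
    refine tendsto_lintegral_of_dominated_convergence' (fun a => b a ^ 2)
      (fun j => (hg j).enorm.pow_const 2) (fun j => ?_) hb ?_
    · filter_upwards [hle j] with a ha using pow_le_pow_left' ha 2
    · filter_upwards [hlim] with a ha
      simpa only [enorm_zero, ne_eq, two_ne_zero, not_false_eq_true, zero_pow] using
        ENNReal.Tendsto.pow (n := 2) ha.enorm
  have hsqrt := (ENNReal.continuous_rpow_const (y := (2 : ℝ)⁻¹)).tendsto 0 |>.comp hsq
  rw [ENNReal.zero_rpow_of_pos (by norm_num)] at hsqrt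
  refine hsqrt.congr fun j => ?_
  exact ENNReal.pow_rpow_inv_natCast two_ne_zero _

end LpSpaces

section Kernels

variable {α β F G H : Type*} [MeasurableSpace α] [MeasurableSpace β] {μ : Measure α}
  {ν : Measure β} [SFinite ν] [NormedAddCommGroup F] [NormedAddCommGroup G]
  [NormedAddCommGroup H] {κ : α × β → F} {w : β → G} {J : α × β → H}

theorem lintegral_eLpNorm_two_sq_prod (hκ : AEStronglyMeasurable κ (μ.prod ν)) :
    ∫⁻ a, eLpNorm (fun b => κ (a, b)) 2 ν ^ 2 ∂μ = eLpNorm κ 2 (μ.prod ν) ^ 2 := by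
  simp_rw [eLpNorm_two_sq]
  rw [lintegral_prod _ (hκ.enorm.pow_const 2)]

theorem ae_memLp_two_of_prod (hκ : MemLp κ 2 (μ.prod ν)) :
    ∀ᵐ a ∂μ, MemLp (fun b => κ (a, b)) 2 ν := by
  have hfin : ∫⁻ a, eLpNorm (fun b => κ (a, b)) 2 ν ^ 2 ∂μ ≠ ∞ := by
    rw [lintegral_eLpNorm_two_sq_prod hκ.1]
    exact ENNReal.pow_ne_top hκ.2.ne
  have hmeas : AEMeasurable (fun a => eLpNorm (fun b => κ (a, b)) 2 ν ^ 2) μ := by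
    simp_rw [eLpNorm_two_sq]
    exact (hκ.1.enorm.pow_const 2).lintegral_prod_right'
  filter_upwards [hκ.1.prodMk_left, ae_lt_top' hmeas hfin] with a ha hlt
  exact ⟨ha, (ENNReal.pow_lt_top_iff.mp hlt).resolve_right two_ne_zero⟩

theorem ae_lintegral_enorm_le_of_kernel_dominated (hκ : AEStronglyMeasurable κ (μ.prod ν))
    (hw : AEStronglyMeasurable w ν) (hle : ∀ᵐ p ∂μ.prod ν, ‖J p‖ ≤ ‖κ p‖ * ‖w p.2‖) :
    ∀ᵐ a ∂μ, ∫⁻ b, ‖J (a, b)‖ₑ ∂ν ≤ eLpNorm (fun b => κ (a, b)) 2 ν * eLpNorm w 2 ν := by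
  filter_upwards [Measure.ae_ae_of_ae_prod hle, hκ.prodMk_left] with a ha hκa
  refine le_trans (lintegral_mono_ae ?_) (lintegral_enorm_mul_le_eLpNorm_two hκa hw)
  filter_upwards [ha] with b hb
  rw [← enorm_norm (J (a, b)), ← enorm_norm (κ (a, b)), ← enorm_norm (w b), ← enorm_mul]
  refine enorm_le_iff_norm_le.mpr ?_
  simpa only [norm_norm, norm_mul] using hb

theorem ae_integrable_of_kernel_dominated (hκ : MemLp κ 2 (μ.prod ν)) (hw : MemLp w 2 ν)
    (hJ : AEStronglyMeasurable J (μ.prod ν)) (hle : ∀ᵐ p ∂μ.prod ν, ‖J p‖ ≤ ‖κ p‖ * ‖w p.2‖) :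
    ∀ᵐ a ∂μ, Integrable (fun b => J (a, b)) ν := by
  filter_upwards [ae_lintegral_enorm_le_of_kernel_dominated hκ.1 hw.1 hle, hJ.prodMk_left,
    ae_memLp_two_of_prod hκ] with a ha hJa hκa
  exact ⟨hJa, ha.trans_lt (ENNReal.mul_lt_top hκa.2 hw.2)⟩

variable [NormedSpace ℝ H]

theorem eLpNorm_integral_le_of_kernel_dominated (hκ : AEStronglyMeasurable κ (μ.prod ν))
    (hw : MemLp w 2 ν) (hle : ∀ᵐ p ∂μ.prod ν, ‖J p‖ ≤ ‖κ p‖ * ‖w p.2‖) :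
    eLpNorm (fun a => ∫ b, J (a, b) ∂ν) 2 μ ≤ eLpNorm κ 2 (μ.prod ν) * eLpNorm w 2 ν := by
  rw [← ENNReal.pow_le_pow_left_iff two_ne_zero, mul_pow, eLpNorm_two_sq,
    ← lintegral_eLpNorm_two_sq_prod hκ, ← lintegral_mul_const' _ _ (ENNReal.pow_ne_top hw.2.ne)]
  refine lintegral_mono_ae ?_
  filter_upwards [ae_lintegral_enorm_le_of_kernel_dominated hκ hw.1 hle] with a ha
  rw [← mul_pow]
  exact pow_le_pow_left' ((enorm_integral_le_lintegral_enorm _).trans ha) 2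

theorem memLp_integral_of_kernel_dominated (hκ : MemLp κ 2 (μ.prod ν))
    (hw : MemLp w 2 ν) (hJ : AEStronglyMeasurable J (μ.prod ν))
    (hle : ∀ᵐ p ∂μ.prod ν, ‖J p‖ ≤ ‖κ p‖ * ‖w p.2‖) :
    MemLp (fun a => ∫ b, J (a, b) ∂ν) 2 μ :=
  ⟨hJ.integral_prod_right', (eLpNorm_integral_le_of_kernel_dominated hκ.1 hw hle).trans_lt
    (ENNReal.mul_lt_top hκ.2 hw.2)⟩

end Kernels

/-- Weak convergence of a sequence in a real inner product space. -/
def TendstoWeakly {H : Type*} [NormedAddCommGroup H] [InnerProductSpace ℝ H] (u : ℕ → H)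
    (u₀ : H) : Prop :=
  ∀ w, Tendsto (fun j => inner ℝ w (u j)) atTop (𝓝 (inner ℝ w u₀))

namespace TendstoWeakly

variable {H : Type*} [NormedAddCommGroup H] [InnerProductSpace ℝ H] {u : ℕ → H} {u₀ : H}

theorem of_tendsto (hu : Tendsto u atTop (𝓝 u₀)) : TendstoWeakly u u₀ :=
  fun _ => tendsto_const_nhds.inner hu

theorem sub_const (hu : TendstoWeakly u u₀) : TendstoWeakly (fun j => u j - u₀) 0 := fun w => by
  simpa only [inner_sub_right, inner_zero_right, sub_self] using (hu w).sub_const (inner ℝ w u₀)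

theorem exists_norm_le [CompleteSpace H] (hu : TendstoWeakly u u₀) : ∃ C, ∀ j, ‖u j‖ ≤ C := by
  obtain ⟨C, hC⟩ := banach_steinhaus (g := fun j => innerSL ℝ (u j)) fun w => by
    obtain ⟨C, hC⟩ := (hu w).norm.bddAbove_range
    exact ⟨C, fun j => by simpa only [innerSL_apply_apply, real_inner_comm] using hC ⟨j, rfl⟩⟩
  exact ⟨C, fun j => by simpa only [innerSL_apply_norm] using hC j⟩

end TendstoWeakly

theorem exists_tendstoWeakly_subseq {H : Type*} [NormedAddCommGroup H] [InnerProductSpace ℝ H]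
    [CompleteSpace H] [TopologicalSpace.SeparableSpace H] {ρ : ℝ} {u : ℕ → H}
    (hu : ∀ j, ‖u j‖ ≤ ρ) :
    ∃ u₀, ‖u₀‖ ≤ ρ ∧ ∃ φ : ℕ → ℕ, StrictMono φ ∧ TendstoWeakly (u ∘ φ) u₀ := by
  obtain ⟨ℓ, hℓ, φ, hφ, hlim⟩ := WeakDual.isSeqCompact_closedBall ℝ H 0 ρ
    (x := fun j => StrongDual.toWeakDual (InnerProductSpace.toDual ℝ H (u j)))
    (fun j => by simpa using hu j)
  obtain ⟨u₀, hu₀⟩ := (InnerProductSpace.toDual ℝ H).surjective (WeakDual.toStrongDual ℓ)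
  have hℓ_apply (w : H) : ℓ w = inner ℝ w u₀ := by
    rw [real_inner_comm, ← InnerProductSpace.toDual_apply_apply, hu₀]
    rfl
  refine ⟨u₀, ?_, φ, hφ, fun w => ?_⟩
  · have : ‖WeakDual.toStrongDual ℓ‖ ≤ ρ := by simpa using hℓ
    rwa [← hu₀, LinearIsometryEquiv.norm_map] at this
  · rw [← hℓ_apply]
    refine (((WeakDual.eval_continuous w).tendsto ℓ).comp hlim).congr fun j => ?_
    rw [real_inner_comm]
    rfl

section CompleteContinuity

variable {α β F G : Type*} [MeasurableSpace α] [MeasurableSpace β] {μ : Measure α}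
  {ν : Measure β} [NormedAddCommGroup F] [InnerProductSpace ℝ F] [CompleteSpace F]
  [NormedAddCommGroup G] [InnerProductSpace ℝ G]

theorem exists_inner_integral_clm_apply_eq [CompleteSpace G] {κ : β → F →L[ℝ] G}
    (hκ : MemLp κ 2 ν) (e : G) :
    ∃ w : Lp F 2 ν, ∀ v : Lp F 2 ν, inner ℝ e (∫ b, κ b (v b) ∂ν) = inner ℝ w v := by
  have hadj : MemLp (fun b => ContinuousLinearMap.adjoint (κ b) e) 2 ν := by
    refine MemLp.of_le_mul (c := ‖e‖) hκ ?_ (Eventually.of_forall fun b => ?_)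
    · exact (ContinuousLinearMap.adjoint.continuous.comp_aestronglyMeasurable
        hκ.1).apply_continuousLinearMap e
    · rw [mul_comm, ← LinearIsometryEquiv.norm_map ContinuousLinearMap.adjoint (κ b)]
      exact ContinuousLinearMap.le_opNorm _ e
  refine ⟨hadj.toLp _, fun v => ?_⟩
  have hint : Integrable (fun b => κ b (v b)) ν :=
    memLp_one_iff_integrable.mp <| hκ.of_bilin (fun L y => L y) 1 (Lp.memLp v)
      (isBoundedBilinearMap_apply.continuous.comp_aestronglyMeasurable
        (hκ.1.prodMk (Lp.aestronglyMeasurable v)))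
      (Eventually.of_forall fun b => by simpa using (κ b).le_opNNNorm (v b))
  rw [L2.inner_def, ← integral_inner hint]
  refine integral_congr_ae ?_
  filter_upwards [hadj.coeFn_toLp] with b hb
  rw [hb, ContinuousLinearMap.adjoint_inner_left]

theorem TendstoWeakly.integral_clm_apply [FiniteDimensional ℝ G] {κ : β → F →L[ℝ] G}
    (hκ : MemLp κ 2 ν) {v : ℕ → Lp F 2 ν} {v₀ : Lp F 2 ν} (hv : TendstoWeakly v v₀) :
    Tendsto (fun j => ∫ b, κ b (v j b) ∂ν) atTop (𝓝 (∫ b, κ b (v₀ b) ∂ν)) := by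
  let e := stdOrthonormalBasis ℝ G
  have coordinate (i) : Tendsto (fun j => inner ℝ (e i) (∫ b, κ b (v j b) ∂ν)) atTop
      (𝓝 (inner ℝ (e i) (∫ b, κ b (v₀ b) ∂ν))) := by
    obtain ⟨w, hw⟩ := exists_inner_integral_clm_apply_eq hκ (e i)
    simpa only [hw] using hv w
  simpa only [e.sum_repr'] using
    tendsto_finsetSum Finset.univ fun i _ => (coordinate i).smul_const (e i)

theorem TendstoWeakly.eLpNorm_integral_clm_apply [SFinite ν] [FiniteDimensional ℝ G]
    {κ : α × β → F →L[ℝ] G} (hκ : MemLp κ 2 (μ.prod ν)) {v : ℕ → Lp F 2 ν}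
    (hv : TendstoWeakly v 0) :
    Tendsto (fun j => eLpNorm (fun a => ∫ b, κ (a, b) (v j b) ∂ν) 2 μ) atTop (𝓝 0) := by
  obtain ⟨C, hC⟩ := hv.exists_norm_le
  have hle (j : ℕ) : ∀ᵐ p ∂μ.prod ν, ‖κ p (v j p.2)‖ ≤ ‖κ p‖ * ‖v j p.2‖ :=
    Eventually.of_forall fun p => (κ p).le_opNorm _
  refine tendsto_eLpNorm_two_of_dominated
    (b := fun a => eLpNorm (fun b => κ (a, b)) 2 ν * ENNReal.ofReal C) (fun j => ?_) ?_
    (fun j => ?_) ?_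
  · have hJ : AEStronglyMeasurable (fun p => κ p (v j p.2)) (μ.prod ν) :=
      isBoundedBilinearMap_apply.continuous.comp_aestronglyMeasurable
        (hκ.1.prodMk (Lp.aestronglyMeasurable (v j)).comp_snd)
    exact hJ.integral_prod_right'
  · simp_rw [mul_pow]
    rw [lintegral_mul_const' _ _ (by simp), lintegral_eLpNorm_two_sq_prod hκ.1]
    exact ENNReal.mul_ne_top (ENNReal.pow_ne_top hκ.2.ne) (by simp)
  · have hvj : eLpNorm (v j) 2 ν ≤ ENNReal.ofReal C := by
      rw [← Lp.enorm_def, ← ofReal_norm]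
      exact ENNReal.ofReal_le_ofReal (hC j)
    filter_upwards [ae_lintegral_enorm_le_of_kernel_dominated hκ.1
      (Lp.aestronglyMeasurable (v j)) (hle j)] with a ha
    exact (enorm_integral_le_lintegral_enorm _).trans (ha.trans (by gcongr))
  · filter_upwards [ae_memLp_two_of_prod hκ] with a ha
    have h0 : ∫ b, κ (a, b) ((0 : Lp F 2 ν) b) ∂ν = 0 := by
      refine integral_eq_zero_of_ae ?_
      filter_upwards [Lp.coeFn_zero F 2 ν] with b hb
      simp only [hb, Pi.zero_apply, map_zero]
    exact h0 ▸ hv.integral_clm_apply ha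

end CompleteContinuity

theorem eventually_exists_dist_lt_of_totallyBounded {X ι κ : Type*} [PseudoMetricSpace X]
    {s : Set X} (hs : TotallyBounded s) {l : Filter ι} {p : ι → κ → Prop} {t : κ → Set X}
    (h : ∀ x ∈ s, ∀ ε > 0, ∀ᶠ i in l, ∀ k, p i k → ∃ y ∈ t k, dist x y < ε) {ε : ℝ}
    (hε : 0 < ε) : ∀ᶠ i in l, ∀ k, p i k → ∀ x ∈ s, ∃ y ∈ t k, dist x y < ε := by
  obtain ⟨c, hcs, hcfin, hcover⟩ := Metric.finite_approx_of_totallyBounded hs (ε / 2) (half_pos hε)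
  have hcenters : ∀ᶠ i in l, ∀ z ∈ c, ∀ k, p i k → ∃ y ∈ t k, dist z y < ε / 2 :=
    (eventually_all_finite hcfin).mpr fun z hz => h z (hcs hz) (ε / 2) (half_pos hε)
  filter_upwards [hcenters] with i hi k hk x hx
  obtain ⟨z, hz, hxz⟩ := mem_iUnion₂.mp (hcover hx)
  obtain ⟨y, hy, hzy⟩ := hi z hz k hk
  exact ⟨y, hy, (dist_triangle x z y).trans_lt (by linarith [Metric.mem_ball.mp hxz])⟩

section StepFunctions

variable {α ι G : Type*} [MeasurableSpace α] {μ : Measure α} {P : ι → Set α}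
  [NormedAddCommGroup G]

theorem exists_Lp_ae_eq_on [Finite ι] [IsFiniteMeasure μ]
    (hP : ∀ i, NullMeasurableSet (P i) μ) (hdisj : Pairwise (Disjoint on P)) (c : ι → G)
    (p : ℝ≥0∞) : ∃ v : Lp G p μ, ∀ i, ∀ᵐ a ∂μ, a ∈ P i → v a = c i := by
  have : Fintype ι := Fintype.ofFinite ι
  have hmem : MemLp (fun a => ∑ i, (P i).indicator (fun _ => c i) a) p μ :=
    memLp_finsetSum _ fun i _ =>
      MemLp.of_bound (aestronglyMeasurable_const.indicator₀ (hP i)) ‖c i‖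
        (Eventually.of_forall fun _ => norm_indicator_le_norm_self _ _)
  refine ⟨hmem.toLp _, fun i => ?_⟩
  filter_upwards [hmem.coeFn_toLp] with a ha hi
  rw [ha, Finset.sum_eq_single i, indicator_of_mem hi]
  · exact fun j _ hji => indicator_of_notMem ((hdisj hji.symm).notMem_of_mem_left hi) _
  · simp

theorem norm_sq_eq_sum_of_ae_eq_on [Fintype ι] [InnerProductSpace ℝ G]
    (hP : ∀ i, NullMeasurableSet (P i) μ) (hdisj : Pairwise (Disjoint on P))
    (hcover : ∀ᵐ a ∂μ, ∃ i, a ∈ P i) {u : Lp G 2 μ} {c : ι → G}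
    (hu : ∀ i, ∀ᵐ a ∂μ, a ∈ P i → u a = c i) : ‖u‖ ^ 2 = ∑ i, μ.real (P i) * ‖c i‖ ^ 2 := by
  have hμ : μ.restrict (⋃ i, P i) = μ :=
    Measure.restrict_eq_self_of_ae_mem (by simpa only [mem_iUnion] using hcover)
  have hint : IntegrableOn (fun a => inner ℝ (u a) (u a)) (⋃ i, P i) μ :=
    (L2.integrable_inner u u).integrableOn
  calc ‖u‖ ^ 2 = ∫ a in ⋃ i, P i, inner ℝ (u a) (u a) ∂μ := by
        rw [hμ, ← L2.inner_def, real_inner_self_eq_norm_sq]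
    _ = ∑ i, ∫ a in P i, inner ℝ (u a) (u a) ∂μ := by
        rw [integral_iUnion_ae hP (hdisj.mono fun _ _ h => h.aedisjoint) hint, tsum_fintype]
    _ = ∑ i, μ.real (P i) * ‖c i‖ ^ 2 := by
        refine Finset.sum_congr rfl fun i _ => ?_
        have hconst : ∀ᵐ a ∂μ, a ∈ P i → inner ℝ (u a) (u a) = ‖c i‖ ^ 2 := by
          filter_upwards [hu i] with a ha hi
          rw [ha hi, real_inner_self_eq_norm_sq]
        rw [setIntegral_congr_ae₀ (hP i) hconst, setIntegral_const, smul_eq_mul]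

end StepFunctions

namespace IsDeltaPartition

variable {k N : ℕ} {Q : Set (EuclideanSpace ℝ (Fin k))} {Δ Δ' : ℝ}
  {P : Fin N → Set (EuclideanSpace ℝ (Fin k))}

theorem mono (h : IsDeltaPartition Q Δ P) (hΔ : Δ ≤ Δ') : IsDeltaPartition Q Δ' P where
  __ := h
  diam_le i x hx y hy := (h.diam_le i x hx y hy).trans hΔ

theorem nullMeasurableSet_restrict (h : IsDeltaPartition Q Δ P) (i : Fin N) :
    NullMeasurableSet (P i) (volume.restrict Q) :=
  (h.measurable i).mono Measure.restrict_le_self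

theorem pairwise_disjoint (h : IsDeltaPartition Q Δ P) : Pairwise (Disjoint on P) :=
  fun i j hij => disjoint_iff_inter_eq_empty.mpr (h.disjoint i j hij)

theorem ae_exists_mem (h : IsDeltaPartition Q Δ P) : ∀ᵐ s ∂volume.restrict Q, ∃ i, s ∈ P i := by
  have hQ : NullMeasurableSet Q := h.union ▸ NullMeasurableSet.iUnion h.measurable
  filter_upwards [ae_restrict_mem₀ hQ] with s hs
  rwa [h.union, mem_iUnion] at hs

theorem norm_sq_eq_sum {m : ℕ} (h : IsDeltaPartition Q Δ P)
    {u : Lp (EuclideanSpace ℝ (Fin m)) 2 (volume.restrict Q)}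
    {c : Fin N → EuclideanSpace ℝ (Fin m)}
    (hu : ∀ i, ∀ᵐ s ∂volume.restrict Q, s ∈ P i → u s = c i) :
    ‖u‖ ^ 2 = ∑ i, volume.real (P i) * ‖c i‖ ^ 2 := by
  have hvolume (i : Fin N) : (volume.restrict Q).real (P i) = volume.real (P i) :=
    congrArg ENNReal.toReal (Measure.restrict_eq_self _ (h.subset i))
  simpa only [hvolume] using norm_sq_eq_sum_of_ae_eq_on h.nullMeasurableSet_restrict
    h.pairwise_disjoint h.ae_exists_mem hu

end IsDeltaPartition

namespace IsUniformPartition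

variable {q : ℕ} {α δ : ℝ} {r : Fin (q + 1) → ℝ}

theorem apply_eq (h : IsUniformPartition α δ r) (i : ℕ) (hi : i < q + 1) :
    r ⟨i, hi⟩ = i * δ := by
  induction i with
  | zero => simpa using h.first
  | succ i ih =>
    have hstep := h.step ⟨i, by omega⟩
    have hprev := ih (by omega)
    simp only [Fin.succ_mk, Fin.castSucc_mk] at hstep
    push_cast
    linarith

theorem exists_abs_sub_le (h : IsUniformPartition α δ r) (hδ : 0 < δ) {t : ℝ}
    (ht : t ∈ Icc 0 α) : ∃ j, |r j - t| ≤ δ := by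
  have hα : q * δ = α := by rw [← h.last, ← h.apply_eq q (by omega)]; rfl
  have hfloor : ⌊t / δ⌋₊ ≤ q := by
    refine Nat.floor_le_of_le ?_
    rw [div_le_iff₀ hδ, hα]
    exact ht.2
  refine ⟨⟨⌊t / δ⌋₊, by omega⟩, ?_⟩
  have hlower : ⌊t / δ⌋₊ * δ ≤ t :=
    (le_div_iff₀ hδ).mp (Nat.floor_le (div_nonneg ht.1 hδ.le))
  have hupper : t < (⌊t / δ⌋₊ + 1) * δ := (div_lt_iff₀ hδ).mp (Nat.lt_floor_add_one _)
  rw [h.apply_eq, abs_le]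
  constructor <;> linarith

end IsUniformPartition

namespace IsSphereNet

variable {m : ℕ} {σ : ℝ} {B : Finset (EuclideanSpace ℝ (Fin m))}

theorem mono {σ' : ℝ} (h : IsSphereNet σ B) (hσ : σ ≤ σ') : IsSphereNet σ' B where
  norm_eq := h.norm_eq
  cover x hx := let ⟨b, hb, hxb⟩ := h.cover x hx; ⟨b, hb, hxb.trans hσ⟩

theorem nonempty (h : IsSphereNet σ B) (hm : 1 ≤ m) : B.Nonempty :=
  let ⟨b, hb, _⟩ := h.cover (EuclideanSpace.single ⟨0, hm⟩ 1) (by simp)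
  ⟨b, hb⟩

theorem norm_smul_sq (h : IsSphereNet σ B) {b : EuclideanSpace ℝ (Fin m)} (hb : b ∈ B) (t : ℝ) :
    ‖t • b‖ ^ 2 = t ^ 2 := by
  rw [norm_smul, h.norm_eq b hb, mul_one, Real.norm_eq_abs, sq_abs]

theorem exists_norm_smul_sub_le (h : IsSphereNet σ B) (hm : 1 ≤ m)
    (c : EuclideanSpace ℝ (Fin m)) : ∃ b ∈ B, ‖‖c‖ • b - c‖ ≤ ‖c‖ * σ := by
  obtain ⟨e, he, hce⟩ : ∃ e : EuclideanSpace ℝ (Fin m), ‖e‖ = 1 ∧ ‖c‖ • e = c := by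
    have : Nonempty (Fin m) := ⟨⟨0, hm⟩⟩
    rcases eq_or_ne c 0 with rfl | hc
    · exact ⟨EuclideanSpace.single ⟨0, hm⟩ 1, by simp, by simp⟩
    · exact ⟨‖c‖⁻¹ • c, norm_smul_inv_norm hc, smul_inv_smul₀ (norm_ne_zero_iff.mpr hc) c⟩
  obtain ⟨b, hb, heb⟩ := h.cover e he
  refine ⟨b, hb, ?_⟩
  calc ‖‖c‖ • b - c‖ = ‖c‖ * ‖e - b‖ := by
        nth_rw 2 [← hce]
        rw [← smul_sub, norm_smul, norm_norm, norm_sub_rev]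
    _ ≤ ‖c‖ * σ := by gcongr

end IsSphereNet

namespace UrysohnSystem

variable {k n m : ℕ} {S : UrysohnSystem k n m} {γ₀ : EuclideanSpace ℝ (Fin k) → ℝ}
  {γ₁ γ₂ : EuclideanSpace ℝ (Fin k) × EuclideanSpace ℝ (Fin k) → ℝ}

theorem CondA.ae_norm_sub_le (hA : S.CondA γ₀) :
    ∀ᵐ ξ ∂S.μE, ∀ x₁ x₂, ‖S.f ξ x₁ - S.f ξ x₂‖ ≤ S.kappa₀ γ₀ * ‖x₁ - x₂‖ := by
  filter_upwards [hA.lipschitz, ae_le_toReal_eLpNorm_top hA.gamma_mem] with ξ hξ hγ x₁ x₂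
  exact (hξ x₁ x₂).trans (mul_le_mul_of_nonneg_right hγ (norm_nonneg _))

theorem CondC.ae_norm_sub_le (hC : S.CondC γ₂) :
    ∀ᵐ p ∂S.μEE, ∀ x₁ x₂,
      ‖S.K₂ p.1 p.2 x₁ - S.K₂ p.1 p.2 x₂‖ ≤ S.kappa₂ γ₂ * ‖x₁ - x₂‖ := by
  filter_upwards [hC.lipschitz, ae_le_toReal_eLpNorm_top hC.gamma_mem] with p hp hγ x₁ x₂
  exact (hp x₁ x₂).trans (mul_le_mul_of_nonneg_right hγ (norm_nonneg _))

theorem CondA.memLp_comp (hA : S.CondA γ₀)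
    {x : EuclideanSpace ℝ (Fin k) → EuclideanSpace ℝ (Fin n)} (hx : MemLp x 2 S.μE) :
    MemLp (fun ξ => S.f ξ (x ξ)) 2 S.μE := by
  refine memLp_of_norm_sub_le (c := S.kappa₀ γ₀)
    (aestronglyMeasurable_comp_of_lipschitz hA.measurable hA.lipschitz hx.1) hA.zero_mem hx ?_
  filter_upwards [hA.ae_norm_sub_le] with ξ hξ
  simpa only [sub_zero] using hξ (x ξ) 0

theorem CondB.aestronglyMeasurable_comp (hB : S.CondB γ₁)
    {x : EuclideanSpace ℝ (Fin k) → EuclideanSpace ℝ (Fin n)} (hx : AEStronglyMeasurable x S.μE) :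
    AEStronglyMeasurable (fun p => S.K₁ p.1 p.2 (x p.2)) S.μEE :=
  aestronglyMeasurable_comp_of_lipschitz (h := fun p : _ × _ => S.K₁ p.1 p.2) (x := fun p => x p.2)
    hB.measurable hB.lipschitz hx.comp_snd

theorem CondC.aestronglyMeasurable_comp (hC : S.CondC γ₂)
    {x : EuclideanSpace ℝ (Fin k) → EuclideanSpace ℝ (Fin n)} (hx : AEStronglyMeasurable x S.μE) :
    AEStronglyMeasurable (fun p => S.K₂ p.1 p.2 (x p.2)) S.μEE :=
  aestronglyMeasurable_comp_of_lipschitz (h := fun p : _ × _ => S.K₂ p.1 p.2) (x := fun p => x p.2)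
    hC.measurable hC.lipschitz hx.comp_snd

/-- The superposition operator `x ↦ f(·, x(·))` on `L₂(E; ℝⁿ)`. -/
noncomputable def superposition (hA : S.CondA γ₀) (x : S.StateSpace) : S.StateSpace :=
  (hA.memLp_comp (Lp.memLp x)).toLp _

theorem norm_superposition_sub_le (hA : S.CondA γ₀) (x y : S.StateSpace) :
    ‖superposition hA x - superposition hA y‖ ≤ S.kappa₀ γ₀ * ‖x - y‖ := by
  refine Lp.norm_le_mul_norm_of_ae_le_mul ?_
  filter_upwards [Lp.coeFn_sub (superposition hA x) (superposition hA y), Lp.coeFn_sub x y,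
    (hA.memLp_comp (Lp.memLp x)).coeFn_toLp, (hA.memLp_comp (Lp.memLp y)).coeFn_toLp,
    hA.ae_norm_sub_le] with ξ hsub hxy hx hy hξ
  rw [hsub, hxy, Pi.sub_apply, Pi.sub_apply, superposition, superposition, hx, hy]
  exact hξ _ _

/-- The function `(ξ, s) ↦ K₁(ξ, s, x(s)) + K₂(ξ, s, x(s)) u(s)` under the integral sign. -/
noncomputable def integrand (S : UrysohnSystem k n m) (u : S.ControlSpace) (x : S.StateSpace)
    (p : EuclideanSpace ℝ (Fin k) × EuclideanSpace ℝ (Fin k)) : EuclideanSpace ℝ (Fin n) :=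
  S.K₁ p.1 p.2 (x p.2) + S.K₂ p.1 p.2 (x p.2) (u p.2)

theorem aestronglyMeasurable_integrand (hB : S.CondB γ₁) (hC : S.CondC γ₂) (u : S.ControlSpace)
    (x : S.StateSpace) : AEStronglyMeasurable (S.integrand u x) S.μEE :=
  (hB.aestronglyMeasurable_comp (Lp.aestronglyMeasurable x)).add
    (isBoundedBilinearMap_apply.continuous.comp_aestronglyMeasurable
      ((hC.aestronglyMeasurable_comp (Lp.aestronglyMeasurable x)).prodMk
        (Lp.aestronglyMeasurable u).comp_snd))

theorem ae_norm_integrand_sub_le (hB : S.CondB γ₁) (hC : S.CondC γ₂) (u : S.ControlSpace)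
    (x y : S.StateSpace) :
    ∀ᵐ p ∂S.μEE, ‖S.integrand u x p - S.integrand u y p‖ ≤
      ‖γ₁ p + S.kappa₂ γ₂ * ‖u p.2‖‖ * ‖x p.2 - y p.2‖ := by
  filter_upwards [hB.lipschitz, hC.ae_norm_sub_le] with p hp₁ hp₂
  calc ‖S.integrand u x p - S.integrand u y p‖
      = ‖(S.K₁ p.1 p.2 (x p.2) - S.K₁ p.1 p.2 (y p.2)) +
          (S.K₂ p.1 p.2 (x p.2) - S.K₂ p.1 p.2 (y p.2)) (u p.2)‖ := by
        rw [integrand, integrand, add_sub_add_comm, sub_apply]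
    _ ≤ γ₁ p * ‖x p.2 - y p.2‖ + S.kappa₂ γ₂ * ‖x p.2 - y p.2‖ * ‖u p.2‖ :=
        (norm_add_le _ _).trans
          (add_le_add (hp₁ _ _) (ContinuousLinearMap.le_of_opNorm_le _ (hp₂ _ _) _))
    _ = (γ₁ p + S.kappa₂ γ₂ * ‖u p.2‖) * ‖x p.2 - y p.2‖ := by ring
    _ ≤ _ := mul_le_mul_of_nonneg_right (Real.le_norm_self _) (norm_nonneg _)

/-- A Lipschitz constant on `L₂(E; ℝⁿ)` of the right-hand side of the equation, valid for all
controls in `V_ρ`. -/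
noncomputable def contractionConst (S : UrysohnSystem k n m) (ρ κ₀ κ₁ κ₂ : ℝ) : ℝ :=
  κ₀ + |S.lam| * (κ₁ + ρ * κ₂ * √(volume.real S.E))

theorem CondD.contractionConst_lt_one {ρ κ₀ κ₁ κ₂ : ℝ} (hD : S.CondD ρ κ₀ κ₁ κ₂) :
    S.contractionConst ρ κ₀ κ₁ κ₂ < 1 := by
  have hE : √(volume.real S.E) ^ 2 = volume.real S.E := Real.sq_sqrt measureReal_nonneg
  have hD' : 6 * (κ₀ ^ 2 + (|S.lam| * κ₁) ^ 2 +
      (|S.lam| * (ρ * κ₂ * √(volume.real S.E))) ^ 2) < 1 := by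
    simp only [mul_pow, sq_abs, hE]
    simpa only [CondD, mul_assoc] using hD
  rw [contractionConst, mul_add]
  -- Cauchy-Schwarz: the square of a sum of three terms is at most three times the sum of squares
  nlinarith [sq_nonneg (κ₀ - |S.lam| * κ₁),
    sq_nonneg (κ₀ - |S.lam| * (ρ * κ₂ * √(volume.real S.E))),
    sq_nonneg (|S.lam| * κ₁ - |S.lam| * (ρ * κ₂ * √(volume.real S.E)))]

variable [IsFiniteMeasure S.μE]

theorem CondC.memLp_comp (hC : S.CondC γ₂)
    {x : EuclideanSpace ℝ (Fin k) → EuclideanSpace ℝ (Fin n)} (hx : MemLp x 2 S.μE) :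
    MemLp (fun p => S.K₂ p.1 p.2 (x p.2)) 2 S.μEE := by
  refine memLp_of_norm_sub_le (c := S.kappa₂ γ₂) (w := fun p => x p.2)
    (hC.aestronglyMeasurable_comp hx.1) hC.zero_mem (hx.comp_snd S.μE) ?_
  filter_upwards [hC.ae_norm_sub_le] with p hp
  simpa only [sub_zero] using hp (x p.2) 0

theorem exists_kernel_dominating_integrand (hB : S.CondB γ₁) (hC : S.CondC γ₂)
    (u : S.ControlSpace) (x : S.StateSpace) :
    ∃ (κ : EuclideanSpace ℝ (Fin k) × EuclideanSpace ℝ (Fin k) → ℝ)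
      (w : EuclideanSpace ℝ (Fin k) → ℝ), MemLp κ 2 S.μEE ∧ MemLp w 2 S.μE ∧
        ∀ᵐ p ∂S.μEE, ‖S.integrand u x p‖ ≤ ‖κ p‖ * ‖w p.2‖ := by
  refine ⟨fun p => ‖S.K₁ p.1 p.2 0‖ + ‖γ₁ p‖ + ‖S.K₂ p.1 p.2 (x p.2)‖,
    fun s => 1 + ‖x s‖ + ‖u s‖,
    (hB.zero_mem.norm.add hB.gamma_mem.norm).add (hC.memLp_comp (Lp.memLp x)).norm,
    ((memLp_const (1 : ℝ)).add (Lp.memLp x).norm).add (Lp.memLp u).norm, ?_⟩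
  filter_upwards [hB.lipschitz] with p hp
  have hK₁ : ‖S.K₁ p.1 p.2 (x p.2)‖ ≤ ‖S.K₁ p.1 p.2 0‖ + ‖γ₁ p‖ * ‖x p.2‖ := by
    have hx := (norm_le_norm_add_norm_sub' _ _).trans (add_le_add_right (hp (x p.2) 0) _)
    rw [sub_zero] at hx
    exact hx.trans (by gcongr; exact Real.le_norm_self _)
  calc ‖S.integrand u x p‖
      ≤ ‖S.K₁ p.1 p.2 0‖ + ‖γ₁ p‖ * ‖x p.2‖ + ‖S.K₂ p.1 p.2 (x p.2)‖ * ‖u p.2‖ :=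
        (norm_add_le _ _).trans (add_le_add hK₁ (ContinuousLinearMap.le_opNorm _ _))
    _ ≤ (‖S.K₁ p.1 p.2 0‖ + ‖γ₁ p‖ + ‖S.K₂ p.1 p.2 (x p.2)‖) * (1 + ‖x p.2‖ + ‖u p.2‖) := by
        have h₁ := norm_nonneg (S.K₁ p.1 p.2 0)
        have h₂ := norm_nonneg (S.K₂ p.1 p.2 (x p.2))
        have h₃ := norm_nonneg (γ₁ p)
        have h₄ := norm_nonneg (x p.2)
        have h₅ := norm_nonneg (u p.2)
        nlinarith [mul_nonneg h₁ h₄, mul_nonneg h₁ h₅, mul_nonneg h₂ h₄, mul_nonneg h₃ h₅]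
    _ ≤ _ := mul_le_mul (Real.le_norm_self _) (Real.le_norm_self _) (by positivity)
        (norm_nonneg _)

theorem ae_integrable_integrand (hB : S.CondB γ₁) (hC : S.CondC γ₂) (u : S.ControlSpace)
    (x : S.StateSpace) : ∀ᵐ ξ ∂S.μE, Integrable (fun s => S.integrand u x (ξ, s)) S.μE :=
  let ⟨_, _, hκ, hw, hle⟩ := exists_kernel_dominating_integrand hB hC u x
  ae_integrable_of_kernel_dominated hκ hw (aestronglyMeasurable_integrand hB hC u x) hle

theorem memLp_integral_integrand (hB : S.CondB γ₁) (hC : S.CondC γ₂) (u : S.ControlSpace)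
    (x : S.StateSpace) : MemLp (fun ξ => ∫ s in S.E, S.integrand u x (ξ, s)) 2 S.μE :=
  let ⟨_, _, hκ, hw, hle⟩ := exists_kernel_dominating_integrand hB hC u x
  memLp_integral_of_kernel_dominated hκ hw (aestronglyMeasurable_integrand hB hC u x) hle

/-- The Urysohn integral operator `x ↦ ∫_E [K₁(·, s, x(s)) + K₂(·, s, x(s)) u(s)] ds` on
`L₂(E; ℝⁿ)`. -/
noncomputable def integralOp (hB : S.CondB γ₁) (hC : S.CondC γ₂) (u : S.ControlSpace)
    (x : S.StateSpace) : S.StateSpace :=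
  (memLp_integral_integrand hB hC u x).toLp _

theorem integralOp_sub_ae_eq (hB : S.CondB γ₁) (hC : S.CondC γ₂) (u v : S.ControlSpace)
    (x y : S.StateSpace) :
    integralOp hB hC u x - integralOp hB hC v y =ᵐ[S.μE]
      fun ξ => ∫ s in S.E, (S.integrand u x (ξ, s) - S.integrand v y (ξ, s)) := by
  filter_upwards [Lp.coeFn_sub (integralOp hB hC u x) (integralOp hB hC v y),
    (memLp_integral_integrand hB hC u x).coeFn_toLp,
    (memLp_integral_integrand hB hC v y).coeFn_toLp,
    ae_integrable_integrand hB hC u x, ae_integrable_integrand hB hC v y]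
    with ξ hsub hx hy hxint hyint
  rw [hsub, Pi.sub_apply, integralOp, integralOp, hx, hy, integral_sub hxint hyint]

theorem eLpNorm_lipschitz_kernel_le (hB : S.CondB γ₁) {c : ℝ} (hc : 0 ≤ c) (u : S.ControlSpace) :
    eLpNorm (fun p => γ₁ p + c * ‖u p.2‖) 2 S.μEE ≤
      ENNReal.ofReal (S.kappa₁ γ₁ + ‖u‖ * c * √(volume.real S.E)) := by
  have hu : eLpNorm (fun p => c * ‖u p.2‖) 2 S.μEE =
      ENNReal.ofReal (‖u‖ * c * √(volume.real S.E)) := by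
    change eLpNorm (c • fun p : _ × _ => ‖u p.2‖) 2 (S.μE.prod S.μE) = _
    rw [eLpNorm_const_smul, eLpNorm_norm (fun p : _ × _ => u p.2),
      eLpNorm_comp_snd (Lp.aestronglyMeasurable u) ENNReal.ofNat_ne_top, ← Lp.enorm_def]
    have hE : S.μE univ ^ (1 / 2 : ℝ≥0∞).toReal = ENNReal.ofReal √(volume.real S.E) := by
      have hfin : volume S.E ≠ ∞ := by
        simpa only [Measure.restrict_apply_univ] using measure_ne_top S.μE univ
      rw [Measure.restrict_apply_univ, Real.sqrt_eq_rpow,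
        ← ENNReal.ofReal_rpow_of_nonneg measureReal_nonneg (by positivity),
        ofReal_measureReal hfin, one_div, ENNReal.toReal_inv, ENNReal.toReal_ofNat, one_div]
    rw [hE, ← ofReal_norm, ← ofReal_norm, Real.norm_of_nonneg hc,
      ← ENNReal.ofReal_mul (by positivity), ← ENNReal.ofReal_mul (by positivity)]
    ring_nf
  calc _ ≤ eLpNorm γ₁ 2 S.μEE + eLpNorm (fun p => c * ‖u p.2‖) 2 S.μEE :=
        eLpNorm_add_le hB.gamma_mem.1 ((Lp.aestronglyMeasurable u).comp_snd.norm.const_mul _)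
          one_le_two
    _ = _ := by
        rw [hu, kappa₁, ENNReal.ofReal_add ENNReal.toReal_nonneg (by positivity),
          ENNReal.ofReal_toReal hB.gamma_mem.2.ne]

theorem norm_integralOp_sub_le (hB : S.CondB γ₁) (hC : S.CondC γ₂) (u : S.ControlSpace)
    (x y : S.StateSpace) :
    ‖integralOp hB hC u x - integralOp hB hC u y‖ ≤
      (S.kappa₁ γ₁ + ‖u‖ * S.kappa₂ γ₂ * √(volume.real S.E)) * ‖x - y‖ := by
  have hκ₁ : 0 ≤ S.kappa₁ γ₁ := ENNReal.toReal_nonneg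
  have hκ₂ : 0 ≤ S.kappa₂ γ₂ := ENNReal.toReal_nonneg
  have hkernel := eLpNorm_integral_le_of_kernel_dominated (μ := S.μE)
    (hB.gamma_mem.1.add ((Lp.aestronglyMeasurable u).comp_snd.norm.const_mul (S.kappa₂ γ₂)))
    ((Lp.memLp x).sub (Lp.memLp y)) (ae_norm_integrand_sub_le hB hC u x y)
  refine ENNReal.toReal_le_of_le_ofReal (by positivity) ?_
  rw [eLpNorm_congr_ae (integralOp_sub_ae_eq hB hC u u x y), ENNReal.ofReal_mul (by positivity)]
  refine hkernel.trans (mul_le_mul' (eLpNorm_lipschitz_kernel_le hB hκ₂ u) ?_)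
  rw [← eLpNorm_congr_ae (Lp.coeFn_sub x y), Lp.norm_def,
    ENNReal.ofReal_toReal (Lp.eLpNorm_ne_top _)]

/-- The right-hand side of the equation as an operator on `L₂(E; ℝⁿ)`; its fixed points are the
trajectories generated by `u`. -/
noncomputable def stateOp (hA : S.CondA γ₀) (hB : S.CondB γ₁) (hC : S.CondC γ₂)
    (u : S.ControlSpace) (x : S.StateSpace) : S.StateSpace :=
  superposition hA x + S.lam • integralOp hB hC u x

theorem isTrajectory_iff_isFixedPt (hA : S.CondA γ₀) (hB : S.CondB γ₁) (hC : S.CondC γ₂)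
    {u : S.ControlSpace} {x : S.StateSpace} :
    S.IsTrajectory u x ↔ Function.IsFixedPt (stateOp hA hB hC u) x := by
  have hcoe : stateOp hA hB hC u x =ᵐ[S.μE]
      fun ξ => S.f ξ (x ξ) + S.lam • ∫ s in S.E, S.integrand u x (ξ, s) := by
    filter_upwards [Lp.coeFn_add (superposition hA x) (S.lam • integralOp hB hC u x),
      Lp.coeFn_smul S.lam (integralOp hB hC u x), (hA.memLp_comp (Lp.memLp x)).coeFn_toLp,
      (memLp_integral_integrand hB hC u x).coeFn_toLp] with ξ hadd hsmul hf hint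
    rw [stateOp, hadd, Pi.add_apply, hsmul, Pi.smul_apply, superposition, integralOp, hf, hint]
  rw [Function.IsFixedPt, Lp.ext_iff, IsTrajectory]
  constructor <;> intro h
  · filter_upwards [h, hcoe] with ξ hξ hcoeξ
    exact hcoeξ.trans hξ.2.symm
  · filter_upwards [h, hcoe, ae_integrable_integrand hB hC u x] with ξ hξ hcoeξ hint
    exact ⟨hint, hξ.symm.trans hcoeξ⟩

section Contraction

variable {ρ : ℝ} (hA : S.CondA γ₀) (hB : S.CondB γ₁) (hC : S.CondC γ₂)
  (hlt : S.contractionConst ρ (S.kappa₀ γ₀) (S.kappa₁ γ₁) (S.kappa₂ γ₂) < 1)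

theorem integralOp_sub_control_ae_eq (u v : S.ControlSpace) (x : S.StateSpace) :
    integralOp hB hC u x - integralOp hB hC v x =ᵐ[S.μE]
      fun ξ => ∫ s in S.E, S.K₂ ξ s (x s) ((u - v : S.ControlSpace) s) := by
  filter_upwards [integralOp_sub_ae_eq hB hC u v x x] with ξ hξ
  rw [hξ]
  refine integral_congr_ae ?_
  filter_upwards [Lp.coeFn_sub u v] with s hs
  rw [hs, Pi.sub_apply, map_sub, integrand, integrand, add_sub_add_left_eq_sub]

theorem tendsto_stateOp_of_tendstoWeakly {u : ℕ → S.ControlSpace} {u₀ : S.ControlSpace}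
    (hu : TendstoWeakly u u₀) (x : S.StateSpace) :
    Tendsto (fun j => stateOp hA hB hC (u j) x) atTop (𝓝 (stateOp hA hB hC u₀ x)) := by
  refine Tendsto.const_add _ (Tendsto.const_smul ?_ _)
  rw [tendsto_iff_norm_sub_tendsto_zero]
  have hlim := hu.sub_const.eLpNorm_integral_clm_apply (hC.memLp_comp (Lp.memLp x))
  refine ((ENNReal.tendsto_toReal ENNReal.zero_ne_top).comp hlim).congr fun j => ?_
  rw [Lp.norm_def, eLpNorm_congr_ae (integralOp_sub_control_ae_eq hB hC (u j) u₀ x)]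
  rfl

include hlt in
theorem contractingWith_stateOp {u : S.ControlSpace} (hu : u ∈ S.admissible ρ) :
    ContractingWith
      (S.contractionConst ρ (S.kappa₀ γ₀) (S.kappa₁ γ₁) (S.kappa₂ γ₂)).toNNReal
      (stateOp hA hB hC u) := by
  have hκ₂ : 0 ≤ S.kappa₂ γ₂ := ENNReal.toReal_nonneg
  have hu' : ‖u‖ ≤ ρ := hu
  refine ⟨Real.toNNReal_lt_one.mpr hlt, LipschitzWith.of_dist_le' fun x y => ?_⟩
  rw [dist_eq_norm, dist_eq_norm]
  calc ‖stateOp hA hB hC u x - stateOp hA hB hC u y‖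
      = ‖(superposition hA x - superposition hA y) +
          S.lam • (integralOp hB hC u x - integralOp hB hC u y)‖ := by
        rw [stateOp, stateOp, add_sub_add_comm, smul_sub]
    _ ≤ S.kappa₀ γ₀ * ‖x - y‖ +
          |S.lam| * ((S.kappa₁ γ₁ + ‖u‖ * S.kappa₂ γ₂ * √(volume.real S.E)) * ‖x - y‖) := by
        refine (norm_add_le _ _).trans (add_le_add (norm_superposition_sub_le hA x y) ?_)
        rw [norm_smul, Real.norm_eq_abs]
        gcongr
        exact norm_integralOp_sub_le hB hC u x y
    _ ≤ S.kappa₀ γ₀ * ‖x - y‖ +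
          |S.lam| * ((S.kappa₁ γ₁ + ρ * S.kappa₂ γ₂ * √(volume.real S.E)) * ‖x - y‖) := by
        gcongr
    _ = _ := by rw [contractionConst]; ring

/-- The trajectory generated by `u`, which is unique for the controls considered here. For a
control that generates no trajectory the value is arbitrary. -/
noncomputable def solution (S : UrysohnSystem k n m) (u : S.ControlSpace) : S.StateSpace :=
  Classical.epsilon (S.IsTrajectory u)

include hA hB hC hlt

theorem isTrajectory_iff_eq_solution {u : S.ControlSpace} (hu : u ∈ S.admissible ρ)
    {x : S.StateSpace} : S.IsTrajectory u x ↔ x = S.solution u := by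
  have hT := contractingWith_stateOp hA hB hC hlt hu
  have hsol : S.IsTrajectory u (S.solution u) :=
    Classical.epsilon_spec ⟨_, (isTrajectory_iff_isFixedPt hA hB hC).mpr hT.fixedPoint_isFixedPt⟩
  refine ⟨fun hx => ?_, fun hx => hx ▸ hsol⟩
  exact hT.fixedPoint_unique' ((isTrajectory_iff_isFixedPt hA hB hC).mp hx)
    ((isTrajectory_iff_isFixedPt hA hB hC).mp hsol)

theorem trajectories_eq_image_solution {V : Set S.ControlSpace} (hV : V ⊆ S.admissible ρ) :
    S.trajectories V = S.solution '' V := by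
  ext x
  refine exists_congr fun u => and_congr_right fun hu => ?_
  rw [isTrajectory_iff_eq_solution hA hB hC hlt (hV hu), eq_comm]

theorem tendsto_solution_of_tendstoWeakly {u : ℕ → S.ControlSpace} {u₀ : S.ControlSpace}
    (hu : ∀ j, u j ∈ S.admissible ρ) (hu₀ : u₀ ∈ S.admissible ρ) (hlim : TendstoWeakly u u₀) :
    Tendsto (fun j => S.solution (u j)) atTop (𝓝 (S.solution u₀)) := by
  have isFixedPt {v} (hv : v ∈ S.admissible ρ) :
      Function.IsFixedPt (stateOp hA hB hC v) (S.solution v) :=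
    (isTrajectory_iff_isFixedPt hA hB hC).mp
      ((isTrajectory_iff_eq_solution hA hB hC hlt hv).mpr rfl)
  have hresidual := (tendsto_stateOp_of_tendstoWeakly hA hB hC hlim (S.solution u₀)).dist
    (tendsto_const_nhds (x := S.solution u₀))
  rw [isFixedPt hu₀, dist_self] at hresidual
  have hbound (j : ℕ) := (contractingWith_stateOp hA hB hC hlt (hu j)).dist_le_of_fixedPoint
    (S.solution u₀) (isFixedPt (hu j))
  simp only [dist_comm (S.solution u₀)] at hbound
  exact tendsto_iff_dist_tendsto_zero.mpr (squeeze_zero (fun _ => dist_nonneg) hbound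
    (by simpa only [zero_div] using hresidual.div_const _))

theorem continuousOn_solution : ContinuousOn S.solution (S.admissible ρ) := by
  refine continuousOn_iff_continuous_domRestrict.mpr (continuous_iff_seqContinuous.mpr ?_)
  intro u u₀ hu
  exact tendsto_solution_of_tendstoWeakly hA hB hC hlt (fun j => (u j).2) u₀.2
    (.of_tendsto ((continuous_subtype_val.tendsto u₀).comp hu))

theorem isCompact_Z : IsCompact (S.Z ρ) := by
  have : Fact ((2 : ℝ≥0∞) ≠ ∞) := ⟨ENNReal.ofNat_ne_top⟩
  have : TopologicalSpace.SeparableSpace S.ControlSpace := inferInstance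
  rw [Z, trajectories_eq_image_solution hA hB hC hlt Subset.rfl]
  refine IsSeqCompact.isCompact fun x hx => ?_
  choose u hu hux using hx
  obtain ⟨u₀, hu₀, φ, hφ, hlim⟩ := exists_tendstoWeakly_subseq hu
  refine ⟨_, mem_image_of_mem _ hu₀, φ, hφ, ?_⟩
  simpa only [Function.comp_def, hux] using
    tendsto_solution_of_tendstoWeakly hA hB hC hlt (fun j => hu (φ j)) hu₀ hlim

end Contraction

end UrysohnSystem

/-- The parameters `Γ`, `Λ = {r₀, …, r_q}`, `S_σ = B` of a discretization of the set of controls. -/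
structure Discretization (k m : ℕ) where
  N : ℕ
  q : ℕ
  Γ : Fin N → Set (EuclideanSpace ℝ (Fin k))
  r : Fin (q + 1) → ℝ
  B : Finset (EuclideanSpace ℝ (Fin m))

namespace Discretization

variable {k m : ℕ}

/-- `Γ` is a finite partition of `E`, `Λ` a uniform partition of `[0, α]` and `B` a net of the unit
sphere, where a single mesh `τ` bounds `Δ`, `δ` and `σ`. -/
structure IsFine (D : Discretization k m) (E : Set (EuclideanSpace ℝ (Fin k))) (α τ : ℝ) :
    Prop where
  partition : IsDeltaPartition E τ D.Γ
  grid : ∃ δ ∈ Ioc 0 τ, IsUniformPartition α δ D.r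
  net : IsSphereNet τ D.B

variable {D : Discretization k m} {E : Set (EuclideanSpace ℝ (Fin k))} {α τ : ℝ}

theorem IsFine.exists_norm_smul_sub_le (hD : D.IsFine E α τ) (hm : 1 ≤ m)
    {c : EuclideanSpace ℝ (Fin m)} (hc : ‖c‖ ≤ α) :
    ∃ j, ∃ b ∈ D.B, ‖D.r j • b - c‖ ≤ (1 + α) * τ := by
  obtain ⟨δ, ⟨hδ, hδτ⟩, hgrid⟩ := hD.grid
  obtain ⟨j, hj⟩ := hgrid.exists_abs_sub_le hδ ⟨norm_nonneg c, hc⟩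
  obtain ⟨b, hb, hbc⟩ := hD.net.exists_norm_smul_sub_le hm c
  have hτ : 0 ≤ τ := hδ.le.trans hδτ
  refine ⟨j, b, hb, ?_⟩
  calc ‖D.r j • b - c‖ = ‖(D.r j - ‖c‖) • b + (‖c‖ • b - c)‖ := by
        rw [sub_smul, sub_add_sub_cancel]
    _ ≤ |D.r j - ‖c‖| + ‖c‖ * τ := by
        refine (norm_add_le _ _).trans (add_le_add ?_ hbc)
        rw [norm_smul, hD.net.norm_eq b hb, mul_one, Real.norm_eq_abs]
    _ ≤ τ + α * τ := add_le_add (hj.trans hδτ) (mul_le_mul_of_nonneg_right hc hτ)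
    _ = (1 + α) * τ := by ring

/-- The filter on pairs `(α, τ)` expressing that `α` is large and, depending on `α`, the mesh `τ`
is small. -/
def meshFilter : Filter (ℝ × ℝ) :=
  atTop.curry (𝓝[>] 0)

theorem eventually_exists_norm_smul_sub_le (hm : 1 ≤ m) (E : Set (EuclideanSpace ℝ (Fin k)))
    {g : EuclideanSpace ℝ (Fin k) → EuclideanSpace ℝ (Fin m)} (hg : Continuous g)
    (hsupp : HasCompactSupport g) {ω : ℝ} (hω : 0 < ω) :
    ∀ᶠ p in meshFilter, ∀ D : Discretization k m, D.IsFine E p.1 p.2 →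
      ∀ i, ∃ j, ∃ b ∈ D.B, ∀ s ∈ D.Γ i, ‖D.r j • b - g s‖ ≤ ω := by
  obtain ⟨M, hM⟩ := hg.bounded_above_of_compact_support hsupp
  obtain ⟨η, hη, hunif⟩ := Metric.uniformContinuous_iff.mp
    (hsupp.uniformContinuous_of_continuous hg) (ω / 2) (half_pos hω)
  refine eventually_curry_iff.mpr ?_
  filter_upwards [eventually_ge_atTop M, eventually_ge_atTop 0] with α hMα hα
  obtain ⟨τ₀, hτ₀, hτ₀ω⟩ := exists_pos_mul_lt (half_pos hω) (1 + α)
  filter_upwards [Ioo_mem_nhdsGT (lt_min hη hτ₀)] with τ hτ D hD i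
  have hτη : τ < η := hτ.2.trans_le (min_le_left _ _)
  have hττ₀ : τ ≤ τ₀ := hτ.2.le.trans (min_le_right _ _)
  rcases (D.Γ i).eq_empty_or_nonempty with hempty | ⟨s₀, hs₀⟩
  · obtain ⟨b, hb⟩ := hD.net.nonempty hm
    exact ⟨0, b, hb, by simp [hempty]⟩
  · obtain ⟨j, b, hb, hjb⟩ := hD.exists_norm_smul_sub_le hm ((hM s₀).trans hMα)
    refine ⟨j, b, hb, fun s hs => ?_⟩
    have hvalue : ‖D.r j • b - g s₀‖ ≤ ω / 2 :=
      hjb.trans ((mul_le_mul_of_nonneg_left hττ₀ (by positivity)).trans hτ₀ω.le)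
    have hoscillation : ‖g s₀ - g s‖ < ω / 2 := by
      rw [← dist_eq_norm]
      exact hunif ((dist_eq_norm s₀ s).trans_lt
        ((hD.partition.diam_le i s₀ hs₀ s hs).trans_lt hτη))
    calc ‖D.r j • b - g s‖ ≤ ‖D.r j • b - g s₀‖ + ‖g s₀ - g s‖ :=
          norm_sub_le_norm_sub_add_norm_sub _ _ _
      _ ≤ ω := by linarith

end Discretization

theorem exists_continuous_compactSupport_dist_toLp_lt {k m : ℕ}
    {μ : Measure (EuclideanSpace ℝ (Fin k))} [μ.Regular] {ρ : ℝ} (hρ : 0 < ρ)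
    {u : Lp (EuclideanSpace ℝ (Fin m)) 2 μ} (hu : ‖u‖ ≤ ρ) {ε : ℝ} (hε : 0 < ε) :
    ∃ (g : EuclideanSpace ℝ (Fin k) → EuclideanSpace ℝ (Fin m)) (hgLp : MemLp g 2 μ),
      Continuous g ∧ HasCompactSupport g ∧ ‖hgLp.toLp g‖ < ρ ∧ dist u (hgLp.toLp g) < ε := by
  obtain ⟨w, hw, huw⟩ : ∃ w ∈ Metric.ball 0 ρ, dist u w < ε / 2 := by
    refine Metric.mem_closure_iff.mp ?_ (ε / 2) (half_pos hε)
    rw [closure_ball 0 hρ.ne']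
    exact mem_closedBall_zero_iff.mpr hu
  rw [mem_ball_zero_iff] at hw
  have hgap : 0 < min (ε / 2) ((ρ - ‖w‖) / 2) := lt_min (half_pos hε) (half_pos (sub_pos.mpr hw))
  obtain ⟨g, hsupp, hwg, hcont, hgLp⟩ := (Lp.memLp w).exists_hasCompactSupport_eLpNorm_sub_le
    ENNReal.ofNat_ne_top (ENNReal.ofReal_pos.mpr hgap).ne'
  have hdist : ‖w - hgLp.toLp g‖ ≤ min (ε / 2) ((ρ - ‖w‖) / 2) := by
    refine ENNReal.toReal_le_of_le_ofReal hgap.le (le_of_eq_of_le (eLpNorm_congr_ae ?_) hwg)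
    exact (Lp.coeFn_sub _ _).trans (EventuallyEq.rfl.sub hgLp.coeFn_toLp)
  refine ⟨g, hgLp, hcont, hsupp, ?_, ?_⟩
  · linarith [norm_le_norm_add_norm_sub w (hgLp.toLp g), min_le_right (ε / 2) ((ρ - ‖w‖) / 2)]
  · rw [← dist_eq_norm] at hdist
    linarith [dist_triangle u w (hgLp.toLp g), min_le_left (ε / 2) ((ρ - ‖w‖) / 2)]

namespace UrysohnSystem

variable {k n m : ℕ} {S : UrysohnSystem k n m}

section DiscreteControls

variable {D : Discretization k m} {α τ ρ : ℝ}

theorem mem_discreteControls_iff_norm_le (hD : D.IsFine S.E α τ) (hρ : 0 ≤ ρ)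
    {u : S.ControlSpace} {j : Fin D.N → Fin (D.q + 1)} {b : Fin D.N → EuclideanSpace ℝ (Fin m)}
    (hb : ∀ i, b i ∈ D.B) (hu : ∀ i, ∀ᵐ s ∂S.μE, s ∈ D.Γ i → u s = D.r (j i) • b i) :
    ∑ i, volume.real (D.Γ i) * D.r (j i) ^ 2 ≤ ρ ^ 2 ↔ ‖u‖ ≤ ρ := by
  rw [← sq_le_sq₀ (norm_nonneg u) hρ, hD.partition.norm_sq_eq_sum hu]
  simp only [hD.net.norm_smul_sq (hb _)]

theorem discreteControls_subset_admissible (hD : D.IsFine S.E α τ) (hρ : 0 ≤ ρ) :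
    S.discreteControls ρ D.Γ D.r D.B ⊆ S.admissible ρ := by
  rintro u ⟨j, b, hb, hu, hsum⟩
  exact (mem_discreteControls_iff_norm_le hD hρ hb hu).mp hsum

theorem finite_discreteControls (hD : D.IsFine S.E α τ) :
    (S.discreteControls ρ D.Γ D.r D.B).Finite := by
  have hvalues : (⋃ c : Fin D.N → Fin (D.q + 1) × D.B, {u : S.ControlSpace |
      ∀ i, ∀ᵐ s ∂S.μE, s ∈ D.Γ i → u s = D.r (c i).1 • (c i).2.1}).Finite := by
    refine finite_iUnion fun c => Subsingleton.finite fun u hu v hv => Lp.ext ?_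
    filter_upwards [hD.partition.ae_exists_mem, ae_all_iff.mpr hu, ae_all_iff.mpr hv]
      with s ⟨i, hi⟩ hus hvs
    rw [hus i hi, hvs i hi]
  refine hvalues.subset ?_
  rintro u ⟨j, b, hb, hu, -⟩
  exact mem_iUnion.mpr ⟨fun i => (j i, ⟨b i, hb i⟩), hu⟩

theorem zero_mem_discreteControls (hD : D.IsFine S.E α τ) (hm : 1 ≤ m) :
    0 ∈ S.discreteControls ρ D.Γ D.r D.B := by
  obtain ⟨δ, -, hgrid⟩ := hD.grid
  obtain ⟨b, hb⟩ := hD.net.nonempty hm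
  refine ⟨fun _ => 0, fun _ => b, fun _ => hb, fun i => ?_, ?_⟩
  · filter_upwards [Lp.coeFn_zero (EuclideanSpace ℝ (Fin m)) 2 S.μE] with s hs _
    rw [hs, hgrid.first, zero_smul, Pi.zero_apply]
  · simpa [hgrid.first] using sq_nonneg ρ

variable [IsFiniteMeasure S.μE]

theorem exists_mem_discreteControls_dist_le (hD : D.IsFine S.E α τ) {ω : ℝ} (hω : 0 ≤ ω)
    {g : EuclideanSpace ℝ (Fin k) → EuclideanSpace ℝ (Fin m)} (hg : MemLp g 2 S.μE)
    (hsmall : ‖hg.toLp g‖ + S.μE.real univ ^ (2 : ℝ≥0∞).toReal⁻¹ * ω ≤ ρ)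
    (hvalues : ∀ i, ∃ j, ∃ b ∈ D.B, ∀ s ∈ D.Γ i, ‖D.r j • b - g s‖ ≤ ω) :
    ∃ v ∈ S.discreteControls ρ D.Γ D.r D.B,
      dist (hg.toLp g) v ≤ S.μE.real univ ^ (2 : ℝ≥0∞).toReal⁻¹ * ω := by
  choose j b hb hjb using hvalues
  obtain ⟨v, hv⟩ := exists_Lp_ae_eq_on hD.partition.nullMeasurableSet_restrict
    hD.partition.pairwise_disjoint (fun i => D.r (j i) • b i) 2
  have hdist : ‖v - hg.toLp g‖ ≤ S.μE.real univ ^ (2 : ℝ≥0∞).toReal⁻¹ * ω := by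
    refine Lp.norm_le_of_ae_bound hω ?_
    filter_upwards [Lp.coeFn_sub v (hg.toLp g), hg.coeFn_toLp, hD.partition.ae_exists_mem,
      ae_all_iff.mpr hv] with s hsub hgs ⟨i, hi⟩ hvs
    rw [hsub, Pi.sub_apply, hgs, hvs i hi]
    exact hjb i s hi
  have hnorm : ‖v‖ ≤ ρ := (norm_le_norm_add_norm_sub' v (hg.toLp g)).trans
    ((add_le_add_right hdist _).trans hsmall)
  refine ⟨v, ⟨j, b, hb, hv, ?_⟩, by rwa [dist_comm, dist_eq_norm]⟩
  exact (mem_discreteControls_iff_norm_le hD ((norm_nonneg v).trans hnorm) hb hv).mpr hnorm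

end DiscreteControls

variable [IsFiniteMeasure S.μE]

theorem eventually_exists_mem_discreteControls_dist_lt (hm : 1 ≤ m) {ρ : ℝ} (hρ : 0 < ρ)
    {u : S.ControlSpace} (hu : u ∈ S.admissible ρ) {ε : ℝ} (hε : 0 < ε) :
    ∀ᶠ p in Discretization.meshFilter, ∀ D : Discretization k m, D.IsFine S.E p.1 p.2 →
      ∃ v ∈ S.discreteControls ρ D.Γ D.r D.B, dist u v < ε := by
  obtain ⟨g, hgLp, hcont, hsupp, hgρ, hug⟩ :=
    exists_continuous_compactSupport_dist_toLp_lt hρ hu (half_pos hε)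
  obtain ⟨ω, hω, hsmall⟩ := exists_pos_mul_lt (lt_min (half_pos hε) (sub_pos.mpr hgρ))
    (S.μE.real univ ^ (2 : ℝ≥0∞).toReal⁻¹)
  rw [lt_min_iff] at hsmall
  filter_upwards [Discretization.eventually_exists_norm_smul_sub_le hm S.E hcont hsupp hω]
    with p hp D hD
  obtain ⟨v, hv, hgv⟩ :=
    exists_mem_discreteControls_dist_le (ρ := ρ) hD hω.le hgLp (by linarith) (hp D hD)
  exact ⟨v, hv, (dist_triangle _ _ _).trans_lt (by linarith)⟩

variable {γ₀ : EuclideanSpace ℝ (Fin k) → ℝ}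
  {γ₁ γ₂ : EuclideanSpace ℝ (Fin k) × EuclideanSpace ℝ (Fin k) → ℝ} {ρ : ℝ}
  (hA : S.CondA γ₀) (hB : S.CondB γ₁) (hC : S.CondC γ₂)
  (hlt : S.contractionConst ρ (S.kappa₀ γ₀) (S.kappa₁ γ₁) (S.kappa₂ γ₂) < 1)

include hA hB hC hlt

theorem discreteZ_eq_image_solution {D : Discretization k m} {α τ : ℝ} (hD : D.IsFine S.E α τ)
    (hρ : 0 ≤ ρ) :
    S.discreteZ ρ D.Γ D.r D.B = S.solution '' S.discreteControls ρ D.Γ D.r D.B :=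
  trajectories_eq_image_solution hA hB hC hlt (discreteControls_subset_admissible hD hρ)

theorem eventually_exists_mem_discreteZ_dist_lt (hm : 1 ≤ m) (hρ : 0 < ρ) {x : S.StateSpace}
    (hx : x ∈ S.Z ρ) {ε : ℝ} (hε : 0 < ε) :
    ∀ᶠ p in Discretization.meshFilter, ∀ D : Discretization k m, D.IsFine S.E p.1 p.2 →
      ∃ y ∈ S.discreteZ ρ D.Γ D.r D.B, dist x y < ε := by
  rw [Z, trajectories_eq_image_solution hA hB hC hlt Subset.rfl] at hx
  obtain ⟨u, hu, rfl⟩ := hx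
  obtain ⟨η, hη, hcont⟩ :=
    Metric.continuousOn_iff.mp (continuousOn_solution hA hB hC hlt) u hu ε hε
  filter_upwards [eventually_exists_mem_discreteControls_dist_lt hm hρ hu hη] with p hp D hD
  obtain ⟨v, hv, huv⟩ := hp D hD
  rw [discreteZ_eq_image_solution hA hB hC hlt hD hρ.le]
  refine ⟨_, mem_image_of_mem _ hv, ?_⟩
  rw [dist_comm] at huv ⊢
  exact hcont v (discreteControls_subset_admissible hD hρ.le hv) huv

theorem eventually_hausdorffEDist_discreteZ_le (hm : 1 ≤ m) (hρ : 0 < ρ) {ε : ℝ} (hε : 0 < ε) :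
    ∀ᶠ p in Discretization.meshFilter, ∀ D : Discretization k m, D.IsFine S.E p.1 p.2 →
      Metric.hausdorffEDist (S.Z ρ) (S.discreteZ ρ D.Γ D.r D.B) ≤ ENNReal.ofReal ε := by
  filter_upwards [eventually_exists_dist_lt_of_totallyBounded
    (isCompact_Z hA hB hC hlt).totallyBounded (fun x hx ε hε =>
      eventually_exists_mem_discreteZ_dist_lt hA hB hC hlt hm hρ hx hε) hε] with p hp D hD
  refine Metric.hausdorffEDist_le_of_mem_edist (fun x hx => ?_) fun x hx => ?_
  · obtain ⟨y, hy, hxy⟩ := hp D hD x hx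
    exact ⟨y, hy, (edist_dist x y).trans_le (ENNReal.ofReal_le_ofReal hxy.le)⟩
  · obtain ⟨u, hu, hux⟩ := hx
    exact ⟨x, ⟨u, discreteControls_subset_admissible hD hρ.le hu, hux⟩, by simp⟩

end UrysohnSystem

theorem theorem3p1_general {k n m : ℕ} (hm : 1 ≤ m) (S : UrysohnSystem k n m)
    [IsFiniteMeasure S.μE] {ρ : ℝ} (hρ : 0 < ρ) {γ₀ : EuclideanSpace ℝ (Fin k) → ℝ}
    {γ₁ γ₂ : EuclideanSpace ℝ (Fin k) × EuclideanSpace ℝ (Fin k) → ℝ}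
    (hA : S.CondA γ₀) (hB : S.CondB γ₁) (hC : S.CondC γ₂)
    (hlt : S.contractionConst ρ (S.kappa₀ γ₀) (S.kappa₁ γ₁) (S.kappa₂ γ₂) < 1)
    {ε : ℝ} (hε : 0 < ε) :
    ∃ αs : ℝ, 0 < αs ∧ ∃ Δs : ℝ, 0 < Δs ∧ ∃ δs : ℝ, 0 < δs ∧ ∃ σs : ℝ, 0 < σs ∧
      ∀ Δ ∈ Ioc 0 Δs, ∀ δ ∈ Ioc 0 δs, ∀ σ ∈ Ioc 0 σs,
      ∀ (N : ℕ) (Γ : Fin N → Set (EuclideanSpace ℝ (Fin k))), IsDeltaPartition S.E Δ Γ →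
      ∀ (q : ℕ) (r : Fin (q + 1) → ℝ), IsUniformPartition αs δ r →
      ∀ B : Finset (EuclideanSpace ℝ (Fin m)), IsSphereNet σ B →
        (S.discreteZ ρ Γ r B).Nonempty ∧ (S.discreteZ ρ Γ r B).Finite ∧
        S.discreteZ ρ Γ r B ⊆ S.Z ρ ∧
        Metric.hausdorffEDist (S.Z ρ) (S.discreteZ ρ Γ r B) ≤ ENNReal.ofReal ε := by
  obtain ⟨α, hα, hα₀⟩ := ((eventually_curry_iff.mp
    (S.eventually_hausdorffEDist_discreteZ_le hA hB hC hlt hm hρ hε)).and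
    (eventually_gt_atTop 0)).exists
  obtain ⟨τ, hτ, hτ₀⟩ := (hα.and self_mem_nhdsWithin).exists
  refine ⟨α, hα₀, τ, hτ₀, τ, hτ₀, τ, hτ₀, ?_⟩
  intro Δ hΔ δ hδ σ hσ N Γ hΓ q r hr B hB'
  let D : Discretization k m := ⟨N, q, Γ, r, B⟩
  have hD : D.IsFine S.E α τ := ⟨hΓ.mono hΔ.2, ⟨δ, hδ, hr⟩, hB'.mono hσ.2⟩
  have hsub := UrysohnSystem.discreteControls_subset_admissible hD hρ.le
  have himage := S.discreteZ_eq_image_solution hA hB hC hlt hD hρ.le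
  refine ⟨?_, ?_, fun x ⟨u, hu, hux⟩ => ⟨u, hsub hu, hux⟩, hτ D hD⟩
  · exact himage ▸ ⟨_, mem_image_of_mem _ (UrysohnSystem.zero_mem_discreteControls hD hm)⟩
  · exact himage ▸ (UrysohnSystem.finite_discreteControls hD).image _

theorem theorem3p1 {k n m : ℕ} (hm : 1 ≤ m) (S : UrysohnSystem k n m)
    (hE : IsCompact S.E) (hlam : 0 < S.lam) (ρ : ℝ) (hρ : 0 < ρ)
    (γ₀ : EuclideanSpace ℝ (Fin k) → ℝ)
    (γ₁ γ₂ : EuclideanSpace ℝ (Fin k) × EuclideanSpace ℝ (Fin k) → ℝ)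
    (hA : S.CondA γ₀) (hB : S.CondB γ₁) (hC : S.CondC γ₂)
    (hD : S.CondD ρ (S.kappa₀ γ₀) (S.kappa₁ γ₁) (S.kappa₂ γ₂)) :
    ∀ ε : ℝ, 0 < ε →
      ∃ αs : ℝ, 0 < αs ∧ ∃ Δs : ℝ, 0 < Δs ∧ ∃ δs : ℝ, 0 < δs ∧ ∃ σs : ℝ, 0 < σs ∧
        ∀ Δ ∈ Set.Ioc 0 Δs, ∀ δ ∈ Set.Ioc 0 δs, ∀ σ ∈ Set.Ioc 0 σs,
        ∀ (N : ℕ) (Γ : Fin N → Set (EuclideanSpace ℝ (Fin k))), IsDeltaPartition S.E Δ Γ →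
        ∀ (q : ℕ) (r : Fin (q + 1) → ℝ), IsUniformPartition αs δ r →
        ∀ B : Finset (EuclideanSpace ℝ (Fin m)), IsSphereNet σ B →
          (S.discreteZ ρ Γ r B).Nonempty ∧
          (S.discreteZ ρ Γ r B).Finite ∧
          S.discreteZ ρ Γ r B ⊆ S.Z ρ ∧
          Metric.hausdorffEDist (S.Z ρ) (S.discreteZ ρ Γ r B) ≤
            ENNReal.ofReal
              ((S.cStar ρ (S.kappa₀ γ₀) (S.kappa₁ γ₁) (S.kappa₂ γ₂) + 1) * ε) := by
  intro ε hε
  have : IsFiniteMeasure S.μE := isFiniteMeasure_restrict.mpr hE.measure_lt_top.ne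
  have hcStar : 0 ≤ S.cStar ρ (S.kappa₀ γ₀) (S.kappa₁ γ₁) (S.kappa₂ γ₂) := Real.sqrt_nonneg _
  exact theorem3p1_general hm S hρ hA hB hC hD.contractionConst_lt_one (by positivity)
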